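/- Let $n,m\ge 1$ be integers, $\lambda>0$, and let $\alpha_1,\dots,\alpha_n$ be linear forms on $\mathbb R^m$. For $z,w\in\mathbb C^n$ write $zw=\sum_k z_kw_k$ and $|z|^2=z\bar z$. For $t\in\mathbb R^m$ let $A(t)=\mathrm{Diag}(e^{i\alpha_1(t)},\dots,e^{i\alpha_n(t)})$, $t\cdot z=A(t)z$ and $t^{-1}\cdot z=A(-t)z$, and write $t^{-1}$ for $-t$. Let $d\mu_\lambda(z)=(2\pi)^{-n}\lambda^n\,dm(z)$, where $dm$ denotes Lebesgue measure on $\mathbb C^n\cong\mathbb R^{2n}$, and let $\mathcal F_\lambda$ be the Fock space of all entire functions $f$ on $\mathbb C^n$ with $\int|f(z)|^2e^{-\lambda|z|^2/2}\,d\mu_\lambda(z)<\infty$, with inner product $\langle f,g\rangle=\int f\bar g\,e^{-\lambda|z|^2/2}\,d\mu_\lambda$ and coherent states $e_z(w)=\exp(\lambda\bar zw/2)$. The generalized diamond group is $G=\mathbb R^m\times\mathbb C^n\times\mathbb R$ with the multiplication $$(t,z,c)(t',z',c')=\bigl(t+t',\;z+t\cdot z',\;c+c'+\tfrac i4\bigl(z\,\overline{t\cdot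 z'}-(t\cdot z')\,\bar z\bigr)\bigr).$$ Let $\chi$ be a unitary character of $\mathbb R^m$, and let $\pi$ be the representation of $G$ on $\mathcal F_\lambda$ given by $$(\pi(t,z_0,c_0)f)(z)=\chi(t)\exp\left(i\lambda c_0+\tfrac\lambda2\bar z_0z-\tfrac\lambda4|z_0|^2\right)f\bigl(t^{-1}\cdot(z-z_0)\bigr).$$ For an operator $A$ on $\mathcal F_\lambda$ with kernel $k_A(z,w)=\langle Ae_w,e_z\rangle$, the complex Weyl symbol is $$W_0(A)(z)=2^n\int_{\mathbb C^n}k_A(z+w,z-w)\exp\left(\tfrac\lambda2(-z\bar z-w\bar w+z\bar w-\bar zw)\right)d\mu_\lambda(w)$$ whenever this integral converges. Let $g=(t,z_0,c_0)\in G$ be such that $\alpha_k(t)\notin\pi+2\pi\mathbb Z$ for $k=1,\dots,n$. Then, for each $z\in\mathbb C^n$, the integral defining $W_0(\pi(g))(z)$ converges absolutely and $$W_0(\pi(g))(z)=2^n\chi(t)e^{i\lambda c_0}\,\mathrm{Det}(I_n+A(t^{-1}))^{-1}\exp\left(-\lambda(t^{-1}\cdot z_0)\bar z-\lambda|z|^2-\tfrac\lambda4|z_0|^2\right)\exp\left(\tfrac\lambda2(t^{-1}\cdot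 z_0+2z)\,(I_n+A(t))^{-1}\,\overline{(t^{-1}\cdot z_0+2z)}\right),$$ and, equivalently, with $z_0=(a_1,\dots,a_n)$, $$W_0(\pi(g))(z)=2^n\chi(t)e^{i\lambda c_0}\exp\left(-\lambda(t^{-1}\cdot z_0)\bar z-\lambda|z|^2-\tfrac\lambda4|z_0|^2\right)\prod_{k=1}^n(1+e^{-i\alpha_k(t)})^{-1}\exp\left(\tfrac\lambda2\sum_{k=1}^n(1+e^{i\alpha_k(t)})^{-1}\left|e^{-i\alpha_k(t)}a_k+2z_k\right|^2\right).$$ -/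

import Mathlib

open MeasureTheory

noncomputable section

namespace Diamond

/-! ### Notation on `ℂⁿ`

The complex bilinear pairing `zw = ∑ z_k w_k` is `z ⬝ᵥ w`, and `\bar z` is `star z`. -/

/-- `|z|² = ∑ |z_k|²`. -/
def sqNorm {n : ℕ} (z : Fin n → ℂ) : ℝ := ∑ k, ‖z k‖ ^ 2

/-- `ω((z,w),(z',w')) = (i/2)(zw' - z'w)`. -/
def omega {n : ℕ} (p q : (Fin n → ℂ) × (Fin n → ℂ)) : ℂ :=
  Complex.I / 2 * (p.1 ⬝ᵥ q.2 - q.1 ⬝ᵥ p.2)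

/-- The real number `ω((z, \bar z), (w, \bar w))`. -/
def omegaR {n : ℕ} (z w : Fin n → ℂ) : ℝ := (omega (z, star z) (w, star w)).re

theorem omegaR_eq {n : ℕ} (z w : Fin n → ℂ) : omegaR z w = -(z ⬝ᵥ star w).im := by
  have h : w ⬝ᵥ star z = (starRingEnd ℂ) (z ⬝ᵥ star w) := by
    simp [dotProduct, map_sum, mul_comm]
  simp only [omegaR, omega, h]
  simp
  ring

/-- The value of `omegaR` is indeed `ω((z, \bar z), (w, \bar w))`: that number is real. -/
theorem omegaR_coe {n : ℕ} (z w : Fin n → ℂ) :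
    (omegaR z w : ℂ) = omega (z, star z) (w, star w) := by
  have h : w ⬝ᵥ star z = (starRingEnd ℂ) (z ⬝ᵥ star w) := by
    simp [dotProduct, map_sum, mul_comm]
  rw [omegaR_eq]
  simp only [omega, h]
  apply Complex.ext <;> simp
  ring

/-! ### The action of `ℝᵐ` on `ℂⁿ` -/

/-- `A(t) = Diag(e^{iα_1(t)}, …, e^{iα_n(t)})`. -/
def actMatrix {m n : ℕ} (α : Fin n → Module.Dual ℝ (Fin m → ℝ)) (t : Fin m → ℝ) :
    Matrix (Fin n) (Fin n) ℂ :=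
  Matrix.diagonal fun k => Complex.exp (Complex.I * (α k t : ℂ))

/-- `t · z = (e^{iα_1(t)} z_1, …, e^{iα_n(t)} z_n)`. -/
def act {m n : ℕ} (α : Fin n → Module.Dual ℝ (Fin m → ℝ)) (t : Fin m → ℝ) (z : Fin n → ℂ) :
    Fin n → ℂ :=
  fun k => Complex.exp (Complex.I * (α k t : ℂ)) * z k

section act

variable {m n : ℕ} (α : Fin n → Module.Dual ℝ (Fin m → ℝ))

theorem norm_phase (x : ℝ) : ‖Complex.exp (Complex.I * (x : ℂ))‖ = 1 := by
  rw [mul_comm]; exact Complex.norm_exp_ofReal_mul_I x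

theorem act_zero (z : Fin n → ℂ) : act α 0 z = z := by
  funext k; simp [act]

theorem act_add_left (s t : Fin m → ℝ) (z : Fin n → ℂ) :
    act α (s + t) z = act α s (act α t z) := by
  funext k
  simp [act, mul_add, Complex.exp_add, mul_assoc]

theorem act_add (t : Fin m → ℝ) (z w : Fin n → ℂ) :
    act α t (z + w) = act α t z + act α t w := by
  funext k; simp [act, mul_add]

theorem act_sub (t : Fin m → ℝ) (z w : Fin n → ℂ) :
    act α t (z - w) = act α t z - act α t w := by
  funext k; simp [act, mul_sub]

theorem sqNorm_act (t : Fin m → ℝ) (z : Fin n → ℂ) : sqNorm (act α t z) = sqNorm z := by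
  simp [sqNorm, act]

theorem act_dot_star_act (t : Fin m → ℝ) (z w : Fin n → ℂ) :
    act α t z ⬝ᵥ star (act α t w) = z ⬝ᵥ star w := by
  refine Finset.sum_congr rfl fun k _ => ?_
  have h : Complex.exp (Complex.I * (α k t : ℂ)) *
      (starRingEnd ℂ) (Complex.exp (Complex.I * (α k t : ℂ))) = 1 := by
    rw [Complex.mul_conj, Complex.normSq_eq_norm_sq, norm_phase]; simp
  simp only [act, Pi.star_apply, star_mul']
  calc _ = Complex.exp (Complex.I * (α k t : ℂ)) *
      (starRingEnd ℂ) (Complex.exp (Complex.I * (α k t : ℂ))) * (z k * star (w k)) := by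
        simp only [starRingEnd_apply]; ring
    _ = _ := by rw [h, one_mul]

theorem measurePreserving_act (t : Fin m → ℝ) : MeasurePreserving (act α t) := by
  refine volume_preserving_pi (f := fun k (x : ℂ) => Complex.exp (Complex.I * (α k t : ℂ)) * x)
    fun k => ?_
  have h := (rotation ⟨Complex.exp (Complex.I * (α k t : ℂ)),
    mem_sphere_zero_iff_norm.2 (norm_phase _)⟩).measurePreserving
  exact h

theorem differentiable_act (t : Fin m → ℝ) : Differentiable ℂ (act α t) := by
  unfold act; fun_prop

end act

/-! ### The groups -/

/-- The Heisenberg group `H_n = ℂⁿ × ℝ`. -/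
@[ext] structure Heis (n : ℕ) where
  z : Fin n → ℂ
  c : ℝ

instance {n : ℕ} : Mul (Heis n) := ⟨fun g h => ⟨g.z + h.z, g.c + h.c + 1 / 2 * omegaR g.z h.z⟩⟩
instance {n : ℕ} : One (Heis n) := ⟨⟨0, 0⟩⟩
instance {n : ℕ} : Inv (Heis n) := ⟨fun g => ⟨-g.z, -g.c⟩⟩

@[simp] theorem Heis.mul_z {n : ℕ} (g h : Heis n) : (g * h).z = g.z + h.z := rfl
@[simp] theorem Heis.mul_c {n : ℕ} (g h : Heis n) :
    (g * h).c = g.c + h.c + 1 / 2 * omegaR g.z h.z := rfl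
@[simp] theorem Heis.one_z {n : ℕ} : (1 : Heis n).z = 0 := rfl
@[simp] theorem Heis.one_c {n : ℕ} : (1 : Heis n).c = 0 := rfl
@[simp] theorem Heis.inv_z {n : ℕ} (g : Heis n) : (g⁻¹).z = -g.z := rfl
@[simp] theorem Heis.inv_c {n : ℕ} (g : Heis n) : (g⁻¹).c = -g.c := rfl

theorem im_dot_star_self {n : ℕ} (z : Fin n → ℂ) : (z ⬝ᵥ star z).im = 0 := by
  simp only [dotProduct, Complex.im_sum]
  refine Finset.sum_eq_zero fun k _ => ?_
  simp [mul_comm]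

instance {n : ℕ} : Group (Heis n) :=
  Group.ofLeftAxioms
    (fun a b c => by
      ext1
      · simp [add_assoc]
      · simp [omegaR_eq]; ring)
    (fun a => by ext1 <;> simp [omegaR_eq])
    (fun a => by ext1 <;> simp [omegaR_eq, im_dot_star_self])

/-- The generalized diamond group `G = ℝᵐ ⋉ H_n`, whose elements are the triples `(t, z, c)`. -/
@[ext] structure DiamondGroup {m n : ℕ} (α : Fin n → Module.Dual ℝ (Fin m → ℝ)) where
  t : Fin m → ℝ
  z : Fin n → ℂ
  c : ℝ

section group

variable {m n : ℕ} {α : Fin n → Module.Dual ℝ (Fin m → ℝ)}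

/-- `(t,h)(t',h') = (t + t', h (t · h'))`, where `t · (z, c) = (t · z, c)`. -/
instance : Mul (DiamondGroup α) :=
  ⟨fun g h => ⟨g.t + h.t, g.z + act α g.t h.z,
    g.c + h.c + 1 / 2 * omegaR g.z (act α g.t h.z)⟩⟩
instance : One (DiamondGroup α) := ⟨⟨0, 0, 0⟩⟩
instance : Inv (DiamondGroup α) := ⟨fun g => ⟨-g.t, -act α (-g.t) g.z, -g.c⟩⟩

@[simp] theorem mul_t (g h : DiamondGroup α) : (g * h).t = g.t + h.t := rfl
@[simp] theorem mul_z (g h : DiamondGroup α) : (g * h).z = g.z + act α g.t h.z := rfl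
@[simp] theorem mul_c (g h : DiamondGroup α) :
    (g * h).c = g.c + h.c + 1 / 2 * omegaR g.z (act α g.t h.z) := rfl
@[simp] theorem one_t : (1 : DiamondGroup α).t = 0 := rfl
@[simp] theorem one_z : (1 : DiamondGroup α).z = 0 := rfl
@[simp] theorem one_c : (1 : DiamondGroup α).c = 0 := rfl
@[simp] theorem inv_t (g : DiamondGroup α) : (g⁻¹).t = -g.t := rfl
@[simp] theorem inv_z (g : DiamondGroup α) : (g⁻¹).z = -act α (-g.t) g.z := rfl
@[simp] theorem inv_c (g : DiamondGroup α) : (g⁻¹).c = -g.c := rfl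

instance : Group (DiamondGroup α) :=
  Group.ofLeftAxioms
    (fun a b c => by
      ext1
      · simp [add_assoc]
      · simp [act_add_left, act_add, add_assoc]
      · simp [omegaR_eq, act_add_left, act_add, act_dot_star_act]; ring)
    (fun a => by ext1 <;> simp [omegaR_eq, act_zero])
    (fun a => by ext1 <;> simp [omegaR_eq, im_dot_star_self])

end group

/-! ### The Fock space -/

/-- `dμ_λ = (2π)^{-n} λⁿ dm`, with `m` the Lebesgue measure of `ℂⁿ`. -/
def fockMeasure (n : ℕ) (lam : ℝ) : Measure (Fin n → ℂ) :=
  ENNReal.ofReal ((2 * Real.pi) ^ (-(n : ℤ)) * lam ^ n) • volume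

/-- The Gaussian weight `e^{-λ|z|²/2}`. -/
def weight {n : ℕ} (lam : ℝ) (z : Fin n → ℂ) : ℝ := Real.exp (-lam * sqNorm z / 2)

theorem continuous_sqNorm {n : ℕ} : Continuous (sqNorm (n := n)) := by
  unfold sqNorm; fun_prop

theorem continuous_weight {n : ℕ} (lam : ℝ) : Continuous (weight (n := n) lam) := by
  have := continuous_sqNorm (n := n)
  unfold weight; fun_prop

/-- The Fock space `F_λ`: the entire functions `f` on `ℂⁿ` with
`∫ |f|² e^{-λ|z|²/2} dμ_λ < ∞`. -/
def fock (n : ℕ) (lam : ℝ) : Submodule ℂ ((Fin n → ℂ) → ℂ) where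
  carrier := {f | Differentiable ℂ f ∧
    Integrable (fun z => ‖f z‖ ^ 2 * weight lam z) (fockMeasure n lam)}
  zero_mem' := ⟨differentiable_const 0, by simp⟩
  add_mem' := by
    rintro f g ⟨hf, hf'⟩ ⟨hg, hg'⟩
    refine ⟨hf.add hg, ((hf'.const_mul 2).add (hg'.const_mul 2)).mono' ?_ ?_⟩
    · have h1 := hf.continuous
      have h2 := hg.continuous
      have h3 := continuous_weight (n := n) lam
      exact Continuous.aestronglyMeasurable (by fun_prop)
    · refine Filter.Eventually.of_forall fun z => ?_
      have hw : 0 ≤ weight lam z := (Real.exp_pos _).le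
      have h : ‖f z + g z‖ ^ 2 ≤ 2 * ‖f z‖ ^ 2 + 2 * ‖g z‖ ^ 2 := by
        nlinarith [norm_add_le (f z) (g z), norm_nonneg (f z + g z),
          sq_nonneg (‖f z‖ - ‖g z‖)]
      rw [Real.norm_of_nonneg (by positivity)]
      simp only [Pi.add_apply]
      nlinarith
  smul_mem' := by
    rintro c f ⟨hf, hf'⟩
    refine ⟨hf.const_smul c, ?_⟩
    simpa [mul_pow, mul_assoc] using hf'.const_mul (‖c‖ ^ 2)

/-- `⟨f, g⟩ = ∫ f \bar g e^{-λ|z|²/2} dμ_λ`, linear in the first argument. -/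
def fockInner {n : ℕ} {lam : ℝ} (f g : fock n lam) : ℂ :=
  ∫ z, f.1 z * star (g.1 z) * (weight lam z : ℂ) ∂(fockMeasure n lam)

/-- The coherent state `e_z(w) = exp(λ \bar z w / 2)`. -/
def coherentFun {n : ℕ} (lam : ℝ) (z : Fin n → ℂ) : (Fin n → ℂ) → ℂ :=
  fun w => Complex.exp ((lam : ℂ) * (star z ⬝ᵥ w) / 2)

theorem differentiable_dot {n : ℕ} (z : Fin n → ℂ) :
    Differentiable ℂ (fun w : Fin n → ℂ => z ⬝ᵥ w) := by
  unfold dotProduct; fun_prop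

theorem integrable_coherent_aux {lam : ℝ} (hlam : 0 < lam) (a : ℂ) :
    Integrable (fun w : ℂ => Real.exp (lam * (star a * w).re - lam * ‖w‖ ^ 2 / 2)) := by
  have h := (GaussianFourier.integrable_cexp_neg_mul_sq_norm_add
    (V := ℂ) (b := ((lam / 2 : ℝ) : ℂ)) (by simpa using hlam) ((lam : ℝ) : ℂ) a).norm
  refine h.congr (Filter.Eventually.of_forall fun w => ?_)
  simp only [Complex.norm_exp]
  congr 1
  have e1 : ((-((lam / 2 : ℝ) : ℂ)) * (‖w‖ : ℂ) ^ 2 +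
      (lam : ℂ) * ((inner ℝ a w : ℝ) : ℂ)) =
      ((-(lam / 2) * ‖w‖ ^ 2 + lam * inner ℝ a w : ℝ) : ℂ) := by push_cast; ring
  rw [e1, Complex.ofReal_re, Complex.inner]
  simp
  ring

theorem coherentFun_mem {n : ℕ} {lam : ℝ} (hlam : 0 < lam) (z : Fin n → ℂ) :
    coherentFun lam z ∈ fock n lam := by
  have hd := differentiable_dot (star z)
  refine ⟨by unfold coherentFun; fun_prop, ?_⟩
  refine Integrable.smul_measure ?_ ENNReal.ofReal_ne_top
  refine (Integrable.fintype_prod (μ := fun _ => volume)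
    (f := fun k (w : ℂ) => Real.exp (lam * (star (z k) * w).re - lam * ‖w‖ ^ 2 / 2))
    fun k => integrable_coherent_aux hlam (z k)).congr (Filter.Eventually.of_forall fun w => ?_)
  simp only [coherentFun, weight, sqNorm, Complex.norm_exp, ← Real.exp_sum, ← Real.exp_nat_mul,
    ← Real.exp_add]
  congr 1
  rw [Finset.sum_sub_distrib, ← Finset.mul_sum, ← Complex.re_sum, ← Finset.sum_div,
    ← Finset.mul_sum]
  have : ((lam : ℂ) * (star z ⬝ᵥ w) / 2).re = lam * (star z ⬝ᵥ w).re / 2 := by simp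
  rw [this]
  simp only [dotProduct, Pi.star_apply]
  push_cast
  ring

/-- The coherent state `e_z` as an element of `F_λ`. -/
def coherent {n : ℕ} {lam : ℝ} (hlam : 0 < lam) (z : Fin n → ℂ) : fock n lam :=
  ⟨coherentFun lam z, coherentFun_mem hlam z⟩

/-! ### The representations -/

theorem sqNorm_sub {n : ℕ} (z w : Fin n → ℂ) :
    sqNorm (z - w) = sqNorm z + sqNorm w - 2 * (star w ⬝ᵥ z).re := by
  simp only [sqNorm, dotProduct, Complex.re_sum, Finset.mul_sum, ← Finset.sum_add_distrib,
    ← Finset.sum_sub_distrib]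
  refine Finset.sum_congr rfl fun k _ => ?_
  simp [← Complex.normSq_eq_norm_sq, Complex.normSq_apply]
  ring

/-- The multiplier `exp(iλc_0 + (λ/2) \bar z_0 z - (λ/4)|z_0|²)`. -/
def heisFactor {n : ℕ} (lam : ℝ) (h : Heis n) (z : Fin n → ℂ) : ℂ :=
  Complex.exp (Complex.I * lam * h.c + lam / 2 * (star h.z ⬝ᵥ z) - lam / 4 * sqNorm h.z)

theorem norm_heisFactor_sq {n : ℕ} (lam : ℝ) (h : Heis n) (z : Fin n → ℂ) :
    ‖heisFactor lam h z‖ ^ 2 * weight lam z = weight lam (z - h.z) := by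
  simp only [heisFactor, weight, Complex.norm_exp, ← Real.exp_nat_mul, ← Real.exp_add]
  congr 1
  have : (Complex.I * lam * h.c + lam / 2 * (star h.z ⬝ᵥ z) - lam / 4 * sqNorm h.z : ℂ).re
      = lam / 2 * (star h.z ⬝ᵥ z).re - lam / 4 * sqNorm h.z := by
    have e1 : (lam / 2 : ℂ) = ((lam / 2 : ℝ) : ℂ) := by push_cast; ring
    have e2 : (lam / 4 : ℂ) = ((lam / 4 : ℝ) : ℂ) := by push_cast; ring
    rw [e1, e2, Complex.sub_re, Complex.add_re, Complex.re_ofReal_mul, ← Complex.ofReal_mul,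
      Complex.ofReal_re, mul_assoc, ← Complex.ofReal_mul, mul_comm Complex.I,
      Complex.re_ofReal_mul]
    simp
  rw [this, sqNorm_sub]
  push_cast
  ring

theorem heis_mem {n : ℕ} {lam : ℝ} (h : Heis n) {f : (Fin n → ℂ) → ℂ} (hf : f ∈ fock n lam) :
    (fun z => heisFactor lam h z * f (z - h.z)) ∈ fock n lam := by
  obtain ⟨hd, hi⟩ := hf
  have hdot := differentiable_dot (star h.z)
  refine ⟨?_, ?_⟩
  · unfold heisFactor; fun_prop
  · have : (fockMeasure n lam).IsAddRightInvariant := by unfold fockMeasure; infer_instance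
    refine (hi.comp_sub_right h.z).congr (Filter.Eventually.of_forall fun z => ?_)
    simp only [norm_mul, mul_pow, ← norm_heisFactor_sq lam h z]
    ring

theorem heisFactor_mul {n : ℕ} (lam : ℝ) (g h : Heis n) (z : Fin n → ℂ) :
    heisFactor lam (g * h) z = heisFactor lam g z * heisFactor lam h (z - g.z) := by
  simp only [heisFactor, ← Complex.exp_add]
  congr 1
  have hs : sqNorm (g.z + h.z) = sqNorm g.z + sqNorm h.z + 2 * (star h.z ⬝ᵥ g.z).re := by
    have := sqNorm_sub (g.z + h.z) h.z
    simp only [add_sub_cancel_right, dotProduct_add, Complex.add_re] at this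
    have h2 : (star h.z ⬝ᵥ h.z).re = sqNorm h.z := by
      simp [dotProduct, sqNorm, ← Complex.normSq_eq_norm_sq, Complex.normSq_apply]
    linarith
  have hw : (omegaR g.z h.z : ℂ) = -((star h.z ⬝ᵥ g.z).im : ℂ) := by
    rw [omegaR_eq, dotProduct_comm]; push_cast; rfl
  have hri := Complex.re_add_im (star h.z ⬝ᵥ g.z)
  simp only [Heis.mul_z, Heis.mul_c, hs, star_add, add_dotProduct, dotProduct_sub]
  push_cast
  rw [hw]
  set p := star h.z ⬝ᵥ g.z
  linear_combination (-lam / 2 : ℂ) * hri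

/-- The Bargmann–Fock representation of `H_n`:
`(ρ_λ(z_0,c_0)f)(z) = exp(iλc_0 + (λ/2) \bar z_0 z - (λ/4)|z_0|²) f(z - z_0)`. -/
def rho (n : ℕ) (lam : ℝ) : Representation ℂ (Heis n) (fock n lam) where
  toFun h :=
    { toFun := fun f => ⟨fun z => heisFactor lam h z * f.1 (z - h.z), heis_mem h f.2⟩
      map_add' := fun f g => by ext z; simp [mul_add]
      map_smul' := fun c f => by ext z; simp; ring }
  map_one' := by
    ext f z
    simp [heisFactor, sqNorm]
  map_mul' g h := by
    ext f z
    simp [heisFactor_mul, sub_sub, mul_assoc]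

section sigma

variable {m n : ℕ} (α : Fin n → Module.Dual ℝ (Fin m → ℝ)) (lam : ℝ)

theorem sigma_mem (u : ℂ) (t : Fin m → ℝ) {f : (Fin n → ℂ) → ℂ} (hf : f ∈ fock n lam) :
    (fun z => u * f (act α t z)) ∈ fock n lam := by
  obtain ⟨hd, hi⟩ := hf
  have ha := differentiable_act α t
  refine ⟨by fun_prop, ?_⟩
  have hmp : MeasurePreserving (act α t) (fockMeasure n lam) (fockMeasure n lam) :=
    (measurePreserving_act α t).smul_measure _
  refine ((hmp.integrable_comp_of_integrable hi).const_mul (‖u‖ ^ 2)).congr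
    (Filter.Eventually.of_forall fun z => ?_)
  simp [weight, sqNorm_act, mul_pow, mul_assoc]

/-- `(σ(t)f)(z) = χ(t) f(t⁻¹ · z)`. -/
def sigma (χ : AddChar (Fin m → ℝ) Circle) (t : Fin m → ℝ) : fock n lam →ₗ[ℂ] fock n lam where
  toFun f := ⟨fun z => (χ t : ℂ) * f.1 (act α (-t) z), sigma_mem α lam _ (-t) f.2⟩
  map_add' f g := by ext z; simp [mul_add]
  map_smul' c f := by ext z; simp; ring

/-- The generic representation `π(t, h) = ρ_λ(h) σ(t)` of the generalized diamond group. -/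
def diamondRep (χ : AddChar (Fin m → ℝ) Circle) :
    Representation ℂ (DiamondGroup α) (fock n lam) where
  toFun g := rho n lam ⟨g.z, g.c⟩ ∘ₗ sigma α lam χ g.t
  map_one' := by
    ext f z
    simp [rho, sigma, heisFactor, sqNorm, act_zero]
  map_mul' g h := by
    ext f z
    have e : (⟨(g * h).z, (g * h).c⟩ : Heis n) = ⟨g.z, g.c⟩ * ⟨act α g.t h.z, h.c⟩ := by
      ext1 <;> simp
    have hz : act α g.t (act α (-g.t) (z - g.z)) = z - g.z := by
      rw [← act_add_left, add_neg_cancel, act_zero]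
    have e2 : heisFactor lam (⟨act α g.t h.z, h.c⟩ : Heis n) (z - g.z) =
        heisFactor lam ⟨h.z, h.c⟩ (act α (-g.t) (z - g.z)) := by
      have h1 := act_dot_star_act α g.t (act α (-g.t) (z - g.z)) h.z
      rw [hz] at h1
      simp only [heisFactor, sqNorm_act]
      rw [dotProduct_comm, h1, dotProduct_comm]
    have e3 : act α (-h.t + -g.t) (z - (g.z + act α g.t h.z)) =
        act α (-h.t) (act α (-g.t) (z - g.z) - h.z) := by
      rw [act_add_left, ← sub_sub, act_sub α (-g.t), ← act_add_left α (-g.t) g.t,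
        neg_add_cancel, act_zero]
    simp only [rho, sigma, MonoidHom.coe_mk, OneHom.coe_mk, LinearMap.comp_apply,
      LinearMap.coe_mk, AddHom.coe_mk, Module.End.mul_apply, e, heisFactor_mul, e2]
    simp only [Heis.mul_z, mul_t, neg_add_rev, e3, AddChar.map_add_eq_mul, Circle.coe_mul]
    ring

end sigma

/-! ### The complex Weyl correspondence -/

/-- The kernel `k_A(z, w) = ⟨A e_w, e_z⟩` of an operator `A` on `F_λ`. -/
def opKernel {n : ℕ} {lam : ℝ} (hlam : 0 < lam) (A : fock n lam →ₗ[ℂ] fock n lam)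
    (z w : Fin n → ℂ) : ℂ :=
  fockInner (A (coherent hlam w)) (coherent hlam z)

/-- The integrand `k_A(z+w, z-w) exp((λ/2)(-z \bar z - w \bar w + z \bar w - \bar z w))`. -/
def weylIntegrand {n : ℕ} {lam : ℝ} (hlam : 0 < lam) (A : fock n lam →ₗ[ℂ] fock n lam)
    (z w : Fin n → ℂ) : ℂ :=
  opKernel hlam A (z + w) (z - w) *
    Complex.exp (lam / 2 * (-(z ⬝ᵥ star z) - w ⬝ᵥ star w + z ⬝ᵥ star w - star z ⬝ᵥ w))

/-- The complex Weyl symbol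
`W_0(A)(z) = 2ⁿ ∫ k_A(z+w, z-w) exp((λ/2)(-z \bar z - w \bar w + z \bar w - \bar z w)) dμ_λ(w)`,
meaningful whenever the integral converges. -/
def weylSymbol {n : ℕ} {lam : ℝ} (hlam : 0 < lam) (A : fock n lam →ₗ[ℂ] fock n lam)
    (z : Fin n → ℂ) : ℂ :=
  2 ^ n * ∫ w, weylIntegrand hlam A z w ∂(fockMeasure n lam)

end Diamond

end

namespace Diamond

open Complex

theorem volume_preserving_complex_prod :
    MeasurePreserving Complex.measurableEquivRealProd.symm :=
  Complex.volume_preserving_equiv_real_prod.symm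

theorem gaussian_exponent_split (b p q : ℂ) (x : ℝ × ℝ) :
    cexp (-b * (Complex.measurableEquivRealProd.symm x * star (Complex.measurableEquivRealProd.symm x)) +
        p * Complex.measurableEquivRealProd.symm x +
        q * star (Complex.measurableEquivRealProd.symm x)) =
      cexp (-b * (x.1 : ℂ) ^ 2 + (p + q) * x.1 + 0) *
        cexp (-b * (x.2 : ℂ) ^ 2 + (I * (p - q)) * x.2 + 0) := by
  have h : Complex.measurableEquivRealProd.symm x = x.1 + x.2 * I := by
    apply Complex.ext <;> simp [Complex.measurableEquivRealProd]
  have h' : star (Complex.measurableEquivRealProd.symm x) = x.1 - x.2 * I := by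
    rw [h]; apply Complex.ext <;> simp
  rw [h', h, ← Complex.exp_add]
  congr 1
  linear_combination (b * (x.2 : ℂ) ^ 2) * Complex.I_sq

/-- Absolute convergence of a complex Gaussian integral over `ℂ` with linear terms. -/
theorem integrable_cexp_gaussian {b : ℂ} (hb : 0 < b.re) (p q : ℂ) :
    Integrable fun w : ℂ => cexp (-b * (w * star w) + p * w + q * star w) := by
  rw [← volume_preserving_complex_prod.integrable_comp_emb
    Complex.measurableEquivRealProd.symm.measurableEmbedding]
  have hb' : (-b).re < 0 := by simpa using hb
  refine ((integrable_cexp_quadratic' hb' (p + q) 0).mul_prod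
    (integrable_cexp_quadratic' hb' (I * (p - q)) 0)).congr
    (Filter.Eventually.of_forall fun x => ?_)
  exact (gaussian_exponent_split b p q x).symm

/-- `∫ exp(-b|w|² + pw + q \bar w) dm(w) = (π/b) exp(pq/b)` over `ℂ`. -/
theorem integral_cexp_gaussian {b : ℂ} (hb : 0 < b.re) (p q : ℂ) :
    ∫ w : ℂ, cexp (-b * (w * star w) + p * w + q * star w) =
      Real.pi / b * cexp (p * q / b) := by
  have hb' : (-b).re < 0 := by simpa using hb
  have hb0 : b ≠ 0 := by rintro rfl; simp at hb
  rw [← volume_preserving_complex_prod.integral_comp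
    Complex.measurableEquivRealProd.symm.measurableEmbedding]
  simp only [gaussian_exponent_split]
  rw [Measure.volume_eq_prod, integral_prod_mul
    (fun x : ℝ => cexp (-b * (x : ℂ) ^ 2 + (p + q) * x + 0))
    (fun x : ℝ => cexp (-b * (x : ℂ) ^ 2 + (I * (p - q)) * x + 0)),
    integral_cexp_quadratic hb', integral_cexp_quadratic hb', neg_neg]
  have hc : ((Real.pi : ℂ) / b) ≠ 0 :=
    div_ne_zero (by exact_mod_cast Real.pi_ne_zero) hb0
  rw [mul_mul_mul_comm, ← Complex.cpow_add _ _ hc, ← Complex.exp_add]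
  norm_num
  left
  congr 1
  field_simp
  linear_combination ((p - q) ^ 2) * Complex.I_sq

section fockGaussian

variable {n : ℕ} {lam : ℝ} {β : Fin n → ℂ}

theorem cexp_sum_eq_prod (lam : ℝ) (β p q w : Fin n → ℂ) :
    cexp (lam / 2 * ∑ k, (-β k * (w k * star (w k)) + p k * w k + q k * star (w k))) =
      ∏ k, cexp (-(lam / 2 * β k) * (w k * star (w k)) + (lam / 2 * p k) * w k +
        (lam / 2 * q k) * star (w k)) := by
  rw [← Complex.exp_sum, Finset.mul_sum]
  congr 1
  exact Finset.sum_congr rfl fun k _ => by ring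

theorem re_half_mul_pos (hlam : 0 < lam) {b : ℂ} (hb : 0 < b.re) :
    0 < ((lam : ℂ) / 2 * b).re := by
  have e : ((lam : ℂ) / 2) = ((lam / 2 : ℝ) : ℂ) := by push_cast; rfl
  rw [e, Complex.re_ofReal_mul]
  positivity

theorem integrable_fock_gaussian (hlam : 0 < lam) (hβ : ∀ k, 0 < (β k).re)
    (p q : Fin n → ℂ) :
    Integrable (fun w : Fin n → ℂ => cexp (lam / 2 *
      ∑ k, (-β k * (w k * star (w k)) + p k * w k + q k * star (w k)))) (fockMeasure n lam) := by
  refine Integrable.smul_measure ?_ ENNReal.ofReal_ne_top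
  simp only [cexp_sum_eq_prod]
  exact Integrable.fintype_prod (μ := fun _ => volume)
    (f := fun k (u : ℂ) => cexp (-(lam / 2 * β k) * (u * star u) + (lam / 2 * p k) * u +
      (lam / 2 * q k) * star u))
    fun k => integrable_cexp_gaussian (re_half_mul_pos hlam (hβ k)) _ _

/-- The Gaussian integral over `ℂⁿ` with respect to `μ_λ`. -/
theorem integral_fock_gaussian (hlam : 0 < lam) (hβ : ∀ k, 0 < (β k).re)
    (p q : Fin n → ℂ) :
    ∫ w : Fin n → ℂ, cexp (lam / 2 *
      ∑ k, (-β k * (w k * star (w k)) + p k * w k + q k * star (w k))) ∂(fockMeasure n lam) =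
      (∏ k, (β k)⁻¹) * cexp (lam / 2 * ∑ k, (β k)⁻¹ * (p k * q k)) := by
  have hl : (lam : ℂ) ≠ 0 := by exact_mod_cast hlam.ne'
  have hpi : (Real.pi : ℂ) ≠ 0 := by exact_mod_cast Real.pi_ne_zero
  have hc : 0 ≤ (2 * Real.pi) ^ (-(n : ℤ)) * lam ^ n := by positivity
  rw [fockMeasure, integral_smul_measure, ENNReal.toReal_ofReal hc]
  simp only [cexp_sum_eq_prod]
  rw [integral_fintype_prod_volume_eq_prod
    (f := fun k (u : ℂ) => cexp (-(lam / 2 * β k) * (u * star u) + (lam / 2 * p k) * u +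
      (lam / 2 * q k) * star u))]
  have hcn : (((2 * Real.pi) ^ (-(n : ℤ)) * lam ^ n : ℝ) : ℂ) =
      ∏ _k : Fin n, ((2 * Real.pi : ℂ)⁻¹ * lam) := by
    simp [mul_pow]
  rw [Complex.real_smul, hcn, ← Finset.prod_mul_distrib, Finset.mul_sum, Complex.exp_sum,
    ← Finset.prod_mul_distrib]
  refine Finset.prod_congr rfl fun k _ => ?_
  have hβ0 : β k ≠ 0 := fun h => by simpa [h] using hβ k
  rw [integral_cexp_gaussian (re_half_mul_pos hlam (hβ k)), ← mul_assoc]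
  congr 1
  · field_simp
  · congr 1
    field_simp

end fockGaussian

theorem ofReal_sqNorm {n : ℕ} (z : Fin n → ℂ) : (sqNorm z : ℂ) = ∑ k, z k * star (z k) := by
  simp [sqNorm, Complex.mul_conj, Complex.normSq_eq_norm_sq]

section symbol

variable {m n : ℕ} (α : Fin n → Module.Dual ℝ (Fin m → ℝ)) {lam : ℝ}

theorem diamondRep_coherent_apply (hlam : 0 < lam) (χ : AddChar (Fin m → ℝ) Circle)
    (g : DiamondGroup α) (w u : Fin n → ℂ) :
    (diamondRep α lam χ g (coherent hlam w)).1 u =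
      heisFactor lam ⟨g.z, g.c⟩ u *
        ((χ g.t : ℂ) * coherentFun lam w (act α (-g.t) (u - g.z))) := rfl

/-- The kernel of `π(g)` is `k(z, w) = (π(g)e_w)(z)`. -/
theorem opKernel_diamondRep (hlam : 0 < lam) (χ : AddChar (Fin m → ℝ) Circle)
    (g : DiamondGroup α) (z w : Fin n → ℂ) :
    opKernel hlam (diamondRep α lam χ g) z w =
      (diamondRep α lam χ g (coherent hlam w)).1 z := by
  set a : Fin n → ℂ := fun k => cexp (I * (α k (-g.t) : ℂ)) with ha
  have hval : ∀ u, (diamondRep α lam χ g (coherent hlam w)).1 u =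
      ((χ g.t : ℂ) * cexp (I * lam * g.c - lam / 4 * sqNorm g.z -
        lam / 2 * ∑ k, star (w k) * (a k * g.z k))) *
        cexp (lam / 2 * ∑ k, (star (g.z k) + star (w k) * a k) * u k) := by
    intro u
    rw [diamondRep_coherent_apply, heisFactor, coherentFun]
    have e1 : ∑ k, (star (g.z k) + star (w k) * a k) * u k =
        star g.z ⬝ᵥ u + (star w ⬝ᵥ act α (-g.t) (u - g.z) +
          ∑ k, star (w k) * (a k * g.z k)) := by
      simp only [dotProduct, ← Finset.sum_add_distrib]
      refine Finset.sum_congr rfl fun k _ => ?_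
      simp only [act, ha, Pi.star_apply, Pi.sub_apply]
      ring
    have key : cexp (I * lam * g.c + lam / 2 * (star g.z ⬝ᵥ u) - lam / 4 * sqNorm g.z) *
        cexp (lam * (star w ⬝ᵥ act α (-g.t) (u - g.z)) / 2) =
        cexp (I * lam * g.c - lam / 4 * sqNorm g.z -
          lam / 2 * ∑ k, star (w k) * (a k * g.z k)) *
        cexp (lam / 2 * ∑ k, (star (g.z k) + star (w k) * a k) * u k) := by
      rw [← Complex.exp_add, ← Complex.exp_add, e1]
      congr 1
      ring
    linear_combination (χ g.t : ℂ) * key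
  rw [opKernel, fockInner, hval]
  have hint : ∀ u : Fin n → ℂ, (diamondRep α lam χ g (coherent hlam w)).1 u *
      star ((coherent hlam z).1 u) * (weight lam u : ℂ) =
      ((χ g.t : ℂ) * cexp (I * lam * g.c - lam / 4 * sqNorm g.z -
        lam / 2 * ∑ k, star (w k) * (a k * g.z k))) *
      cexp (lam / 2 * ∑ k, (-(1 : ℂ) * (u k * star (u k)) +
        (star (g.z k) + star (w k) * a k) * u k + z k * star (u k))) := by
    intro u
    have hs : star ((coherent hlam z).1 u) = cexp (lam / 2 * ∑ k, z k * star (u k)) := by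
      change (starRingEnd ℂ) (cexp _) = _
      rw [← Complex.exp_conj]
      congr 1
      simp [dotProduct, map_sum, map_ofNat]
      ring
    have hw : (weight lam u : ℂ) = cexp (lam / 2 * ∑ k, -(1 : ℂ) * (u k * star (u k))) := by
      rw [weight, Complex.ofReal_exp, ← Finset.mul_sum, ← ofReal_sqNorm]
      congr 1
      push_cast
      ring
    rw [hval, hs, hw, Finset.sum_add_distrib, Finset.sum_add_distrib, mul_add, mul_add,
      Complex.exp_add, Complex.exp_add]
    ring
  simp only [hint]
  rw [integral_const_mul, integral_fock_gaussian (β := fun _ => 1) hlam (by simp)]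
  simp

theorem re_one_add_phase_pos {x : ℝ} (hx : ∀ j : ℤ, x ≠ Real.pi + 2 * Real.pi * j) :
    0 < (1 + cexp (I * ((-x : ℝ) : ℂ))).re := by
  have h1 : (cexp (I * ((-x : ℝ) : ℂ))).re = Real.cos x := by
    rw [mul_comm, Complex.exp_ofReal_mul_I_re, Real.cos_neg]
  rw [Complex.add_re, h1, Complex.one_re]
  rcases (Real.neg_one_le_cos x).lt_or_eq with h | h
  · linarith
  · obtain ⟨j, hj⟩ := Real.cos_eq_neg_one_iff.1 h.symm
    exact absurd (by rw [← hj]; ring) (hx j)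

theorem weylIntegrand_diamondRep (hlam : 0 < lam) (χ : AddChar (Fin m → ℝ) Circle)
    (t : Fin m → ℝ) (z₀ : Fin n → ℂ) (c₀ : ℝ) (z w : Fin n → ℂ) :
    weylIntegrand hlam (diamondRep α lam χ ⟨t, z₀, c₀⟩) z w =
      ((χ t : ℂ) * cexp (I * lam * c₀) *
        cexp (lam / 2 * ∑ k, (star (z₀ k) * z k +
          star (z k) * (cexp (I * (α k (-t) : ℂ)) * (z k - z₀ k)) - z k * star (z k))
          - lam / 4 * sqNorm z₀)) *
      cexp (lam / 2 * ∑ k, (-(1 + cexp (I * (α k (-t) : ℂ))) * (w k * star (w k)) +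
        (star (z₀ k) + (cexp (I * (α k (-t) : ℂ)) - 1) * star (z k)) * w k +
        ((1 - cexp (I * (α k (-t) : ℂ))) * z k + cexp (I * (α k (-t) : ℂ)) * z₀ k) *
          star (w k))) := by
  rw [weylIntegrand, opKernel_diamondRep, diamondRep_coherent_apply, heisFactor, coherentFun]
  have e : star z₀ ⬝ᵥ (z + w) + star (z - w) ⬝ᵥ act α (-t) (z + w - z₀) +
      (-(z ⬝ᵥ star z) - w ⬝ᵥ star w + z ⬝ᵥ star w - star z ⬝ᵥ w) =
      ∑ k, (star (z₀ k) * z k +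
          star (z k) * (cexp (I * (α k (-t) : ℂ)) * (z k - z₀ k)) - z k * star (z k)) +
      ∑ k, (-(1 + cexp (I * (α k (-t) : ℂ))) * (w k * star (w k)) +
        (star (z₀ k) + (cexp (I * (α k (-t) : ℂ)) - 1) * star (z k)) * w k +
        ((1 - cexp (I * (α k (-t) : ℂ))) * z k + cexp (I * (α k (-t) : ℂ)) * z₀ k) *
          star (w k)) := by
    simp only [dotProduct, ← Finset.sum_add_distrib, ← Finset.sum_sub_distrib,
      ← Finset.sum_neg_distrib]
    refine Finset.sum_congr rfl fun k _ => ?_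
    simp only [act, Pi.star_apply, Pi.sub_apply, Pi.add_apply, star_sub]
    ring
  have key := congrArg (fun x => cexp (I * lam * c₀ - lam / 4 * sqNorm z₀ + lam / 2 * x)) e
  simp only [sub_eq_add_neg (I * lam * c₀ : ℂ), mul_add, Complex.exp_add] at key
  simp only [sub_eq_add_neg _ ((lam : ℂ) / 4 * _), mul_div_right_comm (lam : ℂ), Complex.exp_add]
  linear_combination (χ t : ℂ) * key

/-- The exponents agree coordinatewise, with `a` the phase `e^{-iα}` and `a'` its inverse. -/
theorem exponent_coordinate {a a' : ℂ} (haa : a * a' = 1) (h : 1 + a ≠ 0) (ha' : star a = a')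
    (z z₀ : ℂ) :
    star z₀ * z + star z * (a * (z - z₀)) - z * star z +
      (1 + a)⁻¹ * ((star z₀ + (a - 1) * star z) * ((1 - a) * z + a * z₀)) =
      -2 * (a * z₀ * star z) - 2 * (z * star z) +
        (1 + a')⁻¹ * (‖a * z₀ + 2 * z‖ : ℂ) ^ 2 := by
  have ha0 : a ≠ 0 := left_ne_zero_of_mul_eq_one haa
  have hn : (‖a * z₀ + 2 * z‖ : ℂ) ^ 2 = (a * z₀ + 2 * z) * (a' * star z₀ + 2 * star z) := by
    rw [← Complex.mul_conj', ← ha']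
    simp [map_ofNat]
  have hi : (1 + a')⁻¹ = a * (1 + a)⁻¹ := by
    have : 1 + a = a * (1 + a') := by rw [mul_add, haa]; ring
    rw [this, mul_inv, ← mul_assoc, mul_inv_cancel₀ ha0, one_mul]
  rw [hn, hi]
  field_simp
  linear_combination (-(a * z₀ + 2 * z) * star z₀) * haa

end symbol

end Diamond

theorem mainTheorem4 {m n : ℕ} (α : Fin n → Module.Dual ℝ (Fin m → ℝ))
    {lam : ℝ} (hlam : 0 < lam) (χ : AddChar (Fin m → ℝ) Circle)
    (t : Fin m → ℝ) (z₀ : Fin n → ℂ) (c₀ : ℝ)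
    (ht : ∀ (k : Fin n) (j : ℤ), α k t ≠ Real.pi + 2 * Real.pi * j) (z : Fin n → ℂ) :
    MeasureTheory.Integrable
        (Diamond.weylIntegrand hlam (Diamond.diamondRep α lam χ ⟨t, z₀, c₀⟩) z) (Diamond.fockMeasure n lam) ∧
      Diamond.weylSymbol hlam (Diamond.diamondRep α lam χ ⟨t, z₀, c₀⟩) z =
        2 ^ n * (χ t : ℂ) * Complex.exp (Complex.I * lam * c₀) *
          ((1 + Diamond.actMatrix α (-t)).det)⁻¹ *
          Complex.exp (-lam * (Diamond.act α (-t) z₀ ⬝ᵥ star z) - lam * Diamond.sqNorm z - lam / 4 * Diamond.sqNorm z₀) *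
          Complex.exp (lam / 2 * ((Diamond.act α (-t) z₀ + (2 : ℂ) • z) ⬝ᵥ
            Matrix.mulVec (1 + Diamond.actMatrix α t)⁻¹ (star (Diamond.act α (-t) z₀ + (2 : ℂ) • z)))) ∧
      Diamond.weylSymbol hlam (Diamond.diamondRep α lam χ ⟨t, z₀, c₀⟩) z =
        2 ^ n * (χ t : ℂ) * Complex.exp (Complex.I * lam * c₀) *
          Complex.exp (-lam * (Diamond.act α (-t) z₀ ⬝ᵥ star z) - lam * Diamond.sqNorm z - lam / 4 * Diamond.sqNorm z₀) *
          (∏ k, (1 + Complex.exp (-Complex.I * (α k t : ℂ)))⁻¹) *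
          Complex.exp (lam / 2 * ∑ k, (1 + Complex.exp (Complex.I * (α k t : ℂ)))⁻¹ *
            (‖Complex.exp (-Complex.I * (α k t : ℂ)) * z₀ k + 2 * z k‖ : ℂ) ^ 2) := by
  set a : Fin n → ℂ := fun k => Complex.exp (Complex.I * (α k (-t) : ℂ)) with ha
  set a' : Fin n → ℂ := fun k => Complex.exp (Complex.I * (α k t : ℂ)) with ha'
  have haα : ∀ k, a k = Complex.exp (-Complex.I * (α k t : ℂ)) := fun k => by simp [ha]
  have hpos : ∀ k, 0 < (1 + a k).re := fun k => by
    simpa [ha] using Diamond.re_one_add_phase_pos (ht k)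
  have hne : ∀ k, 1 + a k ≠ 0 := fun k h => by simpa [h] using hpos k
  have haa : ∀ k, a k * a' k = 1 := fun k => by simp [ha, ha', ← Complex.exp_add]
  have hstar : ∀ k, star (a k) = a' k := fun k => by
    change (starRingEnd ℂ) (Complex.exp _) = Complex.exp _
    rw [← Complex.exp_conj]
    simp
  have hne' : ∀ k, 1 + a' k ≠ 0 := fun k h => hne k <| by
    have : 1 + a k = a k * (1 + a' k) := by rw [mul_add, haa]; ring
    rw [this, h, mul_zero]
  have hsymbol : Diamond.weylSymbol hlam (Diamond.diamondRep α lam χ ⟨t, z₀, c₀⟩) z =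
        2 ^ n * (χ t : ℂ) * Complex.exp (Complex.I * lam * c₀) *
          Complex.exp (-lam * (Diamond.act α (-t) z₀ ⬝ᵥ star z) - lam * Diamond.sqNorm z - lam / 4 * Diamond.sqNorm z₀) *
          (∏ k, (1 + a k)⁻¹) *
          Complex.exp (lam / 2 * ∑ k, (1 + a' k)⁻¹ * (‖a k * z₀ k + 2 * z k‖ : ℂ) ^ 2) := by
    have hexp : (lam / 2 * ∑ k, (star (z₀ k) * z k + star (z k) * (a k * (z k - z₀ k)) -
          z k * star (z k)) - lam / 4 * Diamond.sqNorm z₀) +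
        lam / 2 * ∑ k, (1 + a k)⁻¹ * ((star (z₀ k) + (a k - 1) * star (z k)) *
          ((1 - a k) * z k + a k * z₀ k)) =
        (-lam * (Diamond.act α (-t) z₀ ⬝ᵥ star z) - lam * Diamond.sqNorm z -
          lam / 4 * Diamond.sqNorm z₀) +
        lam / 2 * ∑ k, (1 + a' k)⁻¹ * (‖a k * z₀ k + 2 * z k‖ : ℂ) ^ 2 := by
      have h := Finset.sum_congr rfl fun k (_ : k ∈ Finset.univ) =>
        Diamond.exponent_coordinate (haa k) (hne k) (hstar k) (z k) (z₀ k)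
      simp only [Finset.sum_add_distrib, Finset.sum_sub_distrib, ← Finset.mul_sum] at h
      have hd : Diamond.act α (-t) z₀ ⬝ᵥ star z = ∑ k, a k * z₀ k * star (z k) := rfl
      rw [hd, Diamond.ofReal_sqNorm z]
      simp only [Finset.sum_add_distrib, Finset.sum_sub_distrib]
      linear_combination (lam / 2 : ℂ) * h
    rw [Diamond.weylSymbol]
    simp only [Diamond.weylIntegrand_diamondRep]
    rw [MeasureTheory.integral_const_mul,
      Diamond.integral_fock_gaussian (β := fun k => 1 + a k) hlam hpos]
    have hprod := congrArg Complex.exp hexp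
    rw [Complex.exp_add, Complex.exp_add (-_ * _ - _ - _)] at hprod
    linear_combination (2 ^ n * (χ t : ℂ) * Complex.exp (Complex.I * lam * c₀) *
      ∏ k, (1 + a k)⁻¹) * hprod
  refine ⟨?_, ?_, ?_⟩
  · have h := (Diamond.integrable_fock_gaussian (β := fun k => 1 + a k) hlam hpos
      (fun k => star (z₀ k) + (a k - 1) * star (z k))
      (fun k => (1 - a k) * z k + a k * z₀ k)).const_mul
      ((χ t : ℂ) * Complex.exp (Complex.I * lam * c₀) *
        Complex.exp (lam / 2 * ∑ k, (star (z₀ k) * z k +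
          star (z k) * (a k * (z k - z₀ k)) - z k * star (z k)) - lam / 4 * Diamond.sqNorm z₀))
    exact h.congr (Filter.Eventually.of_forall fun w =>
      (Diamond.weylIntegrand_diamondRep α hlam χ t z₀ c₀ z w).symm)
  · have hdet : (1 + Diamond.actMatrix α (-t)).det = ∏ k, (1 + a k) := by
      rw [Diamond.actMatrix, ← Matrix.diagonal_one, Matrix.diagonal_add, Matrix.det_diagonal]
    have hinv : (1 + Diamond.actMatrix α t)⁻¹ = Matrix.diagonal fun k => (1 + a' k)⁻¹ := by
      apply Matrix.inv_eq_right_inv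
      rw [Diamond.actMatrix, ← Matrix.diagonal_one, Matrix.diagonal_add,
        Matrix.diagonal_mul_diagonal]
      congr 1
      funext k
      exact mul_inv_cancel₀ (hne' k)
    have hquad : (Diamond.act α (-t) z₀ + (2 : ℂ) • z) ⬝ᵥ
        Matrix.mulVec (1 + Diamond.actMatrix α t)⁻¹
          (star (Diamond.act α (-t) z₀ + (2 : ℂ) • z)) =
        ∑ k, (1 + a' k)⁻¹ * (‖a k * z₀ k + 2 * z k‖ : ℂ) ^ 2 := by
      rw [hinv, dotProduct]
      refine Finset.sum_congr rfl fun k _ => ?_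
      rw [Matrix.mulVec_diagonal, ← Complex.mul_conj', mul_left_comm]
      rfl
    rw [hsymbol, hdet, hquad, Finset.prod_inv_distrib]
    ring
  · simpa only [haα] using hsymbol
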